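/- Consider the vector-matrix-vector query model: an algorithm with access to a real symmetric $d\times d$ matrix $A$ may choose, adaptively and using random coins, pairs of vectors $(v,w)\in\mathbb{R}^d\times\mathbb{R}^d$, and receives the value $v^TAw$ for each. For $p\in[1,\infty]$ let $\|A\|_p$ be the Schatten-$p$ norm of $A$, i.e. the $\ell_p$ norm of its vector of singular values. For $\epsilon\in(0,1)$, a one-sided $(\epsilon,\ell_p)$-tester is such an algorithm that outputs True on every positive semidefinite input $A$, for every outcome of its random coins, and outputs False with probability at least $2/3$ on every nonzero symmetric $A$ with $\lambda_{\min}(A)\le-\epsilon\|A\|_p$. (As usual, the queries and the output are measurable functions of the coins and of the previous answers.) **Theorem.** For every $\epsilon_0<1$ there is a constant $c=c(\epsilon_0)>0$ such that for all $p\in[1,\infty]$, all $d\ge1$ and all $0<\epsilon\le\epsilon_0$, every adaptive one-sided $(\epsilon,\ell_p)$-tester for $d\times d$ matrices must make at least $$c\cdot\min\Big\{d,\ \frac{d^{1-1/p}}{\epsilon}\Big\}$$ vector-matrix-vector queries (with $1/p=0$ for $p=\infty$). In particular, it must make $\Omega\big(\tfrac1\epsilon d^{1-1/p}\big)$ queries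 whenever $\epsilon\ge d^{-1/p}$, so for any fixed $\epsilon \le \epsilon_0$ and $p<\infty$ the bound holds for all sufficiently large $d$, with a constant that depends only on $\epsilon_0$. -/

import Mathlib

open MeasureTheory
open scoped ENNReal Matrix

namespace PSDTesting

/-- The Schatten-`p` norm of a real square matrix, `p ∈ [1, ∞]`: the `ℓ_p` norm of the vector of
its singular values. -/
noncomputable def schattenNorm {d : ℕ} (p : ℝ≥0∞) (A : Matrix (Fin d) (Fin d) ℝ) : ℝ :=
  ‖WithLp.toLp p (fun i : Fin d => (Matrix.toEuclideanLin A).singularValues i)‖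

/-- The far inputs: nonzero symmetric matrices whose smallest eigenvalue is at most `-ε ‖A‖_p`
(equivalently, having some eigenvalue that is at most `-ε ‖A‖_p`). The zero matrix, which is PSD
but satisfies `λ_min ≤ -ε ‖A‖_p` as `0 ≤ 0`, is excluded. -/
def IsFarFromPSD {d : ℕ} (ε : ℝ) (p : ℝ≥0∞) (A : Matrix (Fin d) (Fin d) ℝ) : Prop :=
  A ≠ 0 ∧ ∃ hA : A.IsHermitian, ∃ i, hA.eigenvalues i ≤ -(ε * schattenNorm p A)

/-- A randomized adaptive algorithm making (at most) `q` vector-matrix-vector queries to a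
`d × d` matrix, with random seed in `Ω`. The `i`-th query is a pair of vectors that depends on the
seed and on the answers to the queries `0, …, i - 1`; the output (`true` or `false`) depends on the
seed and on all `q` answers. Everything is jointly measurable in the seed and the answers.
An algorithm that stops early is padded with zero queries. -/
structure AdaptiveVMV (d q : ℕ) (Ω : Type*) [MeasurableSpace Ω] where
  query : (i : ℕ) → Ω × (Fin i → ℝ) → (Fin d → ℝ) × (Fin d → ℝ)
  measurable_query : ∀ i, Measurable (query i)
  output : Ω × (Fin q → ℝ) → Bool
  measurable_output : Measurable output

namespace AdaptiveVMV

variable {d q : ℕ} {Ω : Type*} [MeasurableSpace Ω]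

/-- The answers `vᵀ A w` to the first `k` queries, on seed `ω` and input matrix `A`. -/
def answers (T : AdaptiveVMV d q Ω) (A : Matrix (Fin d) (Fin d) ℝ) (ω : Ω) :
    (k : ℕ) → (Fin k → ℝ)
  | 0 => Fin.elim0
  | k + 1 =>
    Fin.snoc (α := fun _ => ℝ) (T.answers A ω k)
      ((T.query k (ω, T.answers A ω k)).1 ⬝ᵥ (A *ᵥ (T.query k (ω, T.answers A ω k)).2))

/-- The output on seed `ω` and input matrix `A`, after `q` queries. -/
def run (T : AdaptiveVMV d q Ω) (A : Matrix (Fin d) (Fin d) ℝ) (ω : Ω) : Bool :=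
  T.output (ω, T.answers A ω q)

/-- `T`, with its seed drawn from `μ`, is an `(ε, ℓ_p)`-tester: it outputs `true` with probability
at least `2/3` on every PSD input, and `false` with probability at least `2/3` on every far
input. -/
def IsTester (T : AdaptiveVMV d q Ω) (μ : Measure Ω) (ε : ℝ) (p : ℝ≥0∞) : Prop :=
  (∀ A : Matrix (Fin d) (Fin d) ℝ, A.PosSemidef → 2 / 3 ≤ μ {ω | T.run A ω = true}) ∧
  (∀ A : Matrix (Fin d) (Fin d) ℝ, IsFarFromPSD ε p A → 2 / 3 ≤ μ {ω | T.run A ω = false})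

/-- One-sided error: whatever the seed, every PSD input is accepted. -/
def IsOneSided (T : AdaptiveVMV d q Ω) : Prop :=
  ∀ ω, ∀ A : Matrix (Fin d) (Fin d) ℝ, A.PosSemidef → T.run A ω = true

end AdaptiveVMV

end PSDTesting

/-! The hard input is `spike c g` = I - c g gᵀ with g standard Gaussian. Let P project onto the span
of all queried vectors. The answers on A and on P A P coincide, so a one-sided tester can reject A
only if P A P is not PSD; for a spike this forces c gᵀPg > 1 (`IsOneSided.run_spike_eq_true`). Each
query adds at most two dimensions to the range of P. Adaptivity does not help: the answers depend on
g only through its revealed part, so given them the rest of g is still Gaussian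
(`lintegral_resample_answers`), whence E[gᵀPg] ≤ 2q (`lintegral_revealed_le`). By Markov, the
rejection probability is at most 2cq.

On the other hand, g is an eigenvector with eigenvalue -L, where L = c|g|² - 1, and the Schatten
norm is at most d^(1/p) + L when L ≥ 0. So the spike is far once L > 0 and (1 - ε)L ≥ ε d^(1/p).
Since |g|² ≥ βd with probability at least β (`exists_small_ball_gaussianVec`), c of order (1 + ε
d^(1/p))/d suffices, with constants depending on ε₀. The tester must then reject with constant
probability, so q is at least of order 1/c, which is comparable to min(d, d^(1-1/p)/ε). -/

namespace PSDTesting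

/-! ### Orthogonal projections, extended one vector at a time. -/

section Projections

variable {d : ℕ}

/-- An orthogonal projection, as a real square matrix. -/
def IsOrthProj (P : Matrix (Fin d) (Fin d) ℝ) : Prop := Pᵀ = P ∧ P * P = P

/-- The component of `v` orthogonal to the range of the projection `P`. -/
def residual (P : Matrix (Fin d) (Fin d) ℝ) (v : Fin d → ℝ) : Fin d → ℝ := v - P *ᵥ v

/-- The projection onto the span of the range of the projection `P` and of `v`. -/
noncomputable def extendProj (P : Matrix (Fin d) (Fin d) ℝ) (v : Fin d → ℝ) :
    Matrix (Fin d) (Fin d) ℝ :=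
  P + (residual P v ⬝ᵥ residual P v)⁻¹ • Matrix.vecMulVec (residual P v) (residual P v)

variable {P : Matrix (Fin d) (Fin d) ℝ}

lemma IsOrthProj.dotProduct_mulVec_comm (hP : Pᵀ = P) (x y : Fin d → ℝ) :
    (P *ᵥ x) ⬝ᵥ y = x ⬝ᵥ (P *ᵥ y) := by
  rw [Matrix.dotProduct_mulVec, ← Matrix.mulVec_transpose, hP]

lemma IsOrthProj.zero : IsOrthProj (0 : Matrix (Fin d) (Fin d) ℝ) := by
  simp [IsOrthProj]

lemma IsOrthProj.mulVec_residual (hP : IsOrthProj P) (v : Fin d → ℝ) :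
    P *ᵥ residual P v = 0 := by
  simp [residual, Matrix.mulVec_sub, hP.2]

lemma IsOrthProj.residual_vecMul (hP : IsOrthProj P) (v : Fin d → ℝ) :
    residual P v ᵥ* P = 0 := by
  rw [← Matrix.mulVec_transpose, hP.1, hP.mulVec_residual]

lemma IsOrthProj.extendProj_mul (hP : IsOrthProj P) (v : Fin d → ℝ) :
    extendProj P v * P = P := by
  simp [extendProj, Matrix.add_mul, hP.2, Matrix.vecMulVec_mul, hP.residual_vecMul]

lemma IsOrthProj.extendProj (hP : IsOrthProj P) (v : Fin d → ℝ) :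
    IsOrthProj (extendProj P v) := by
  refine ⟨?_, ?_⟩
  · simp [PSDTesting.extendProj, hP.1, Matrix.transpose_vecMulVec]
  · conv_lhs => enter [2]; rw [PSDTesting.extendProj]
    rw [Matrix.mul_add, hP.extendProj_mul, PSDTesting.extendProj]
    congr 1
    set r := residual P v with hr
    rw [Matrix.add_mul, Matrix.mul_smul, Matrix.mul_vecMulVec, hP.mulVec_residual,
      Matrix.smul_mul, Matrix.mul_smul, Matrix.vecMulVec_mul_vecMulVec, smul_smul]
    -- If the vector already lies in the range, the convention 0⁻¹ = 0 leaves the projection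
    -- unchanged.
    by_cases h : r ⬝ᵥ r = 0
    · simp [h]
    · simp only [Matrix.zero_vecMulVec, smul_zero, zero_add, Matrix.vecMulVec_smul, smul_smul]
      congr 1
      field_simp

lemma IsOrthProj.extendProj_mulVec (hP : IsOrthProj P) (v : Fin d → ℝ) :
    PSDTesting.extendProj P v *ᵥ v = v := by
  have hrv : residual P v ⬝ᵥ v = residual P v ⬝ᵥ residual P v := by
    conv_rhs => enter [2]; rw [residual]
    rw [dotProduct_sub, ← IsOrthProj.dotProduct_mulVec_comm hP.1, hP.mulVec_residual]
    simp
  have hv : P *ᵥ v + residual P v = v := by simp [residual]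
  by_cases h : residual P v ⬝ᵥ residual P v = 0
  · have h0 := dotProduct_self_eq_zero.1 h
    rw [h0, add_zero] at hv
    simp [PSDTesting.extendProj, h0, hv]
  · rw [PSDTesting.extendProj, Matrix.add_mulVec, Matrix.smul_mulVec, Matrix.vecMulVec_mulVec, hrv]
    conv_rhs => rw [← hv]
    congr 1
    ext i
    simp
    field_simp

/-- Trace stands in for dimension: the added rank-one term has trace 1, or 0 when the residual
vanishes. -/
lemma trace_extendProj_le (P : Matrix (Fin d) (Fin d) ℝ) (v : Fin d → ℝ) :
    (extendProj P v).trace ≤ P.trace + 1 := by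
  rw [extendProj, Matrix.trace_add, Matrix.trace_smul, Matrix.trace_vecMulVec, smul_eq_mul]
  gcongr
  exact inv_mul_le_one

lemma IsOrthProj.dotProduct_mulVec_self (hP : IsOrthProj P) (x : Fin d → ℝ) :
    x ⬝ᵥ (P *ᵥ x) = (P *ᵥ x) ⬝ᵥ (P *ᵥ x) := by
  rw [IsOrthProj.dotProduct_mulVec_comm hP.1, Matrix.mulVec_mulVec, hP.2]

end Projections

/-! ### Spectrum and Schatten norm of the spiked matrix. -/

section Spike

variable {d : ℕ}

/-- The identity matrix with a rank-one matrix `c g gᵀ` subtracted. -/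
def spike (c : ℝ) (g : Fin d → ℝ) : Matrix (Fin d) (Fin d) ℝ := 1 - c • Matrix.vecMulVec g g

lemma spike_mulVec (c : ℝ) (g x : Fin d → ℝ) : spike c g *ᵥ x = x - (c * (g ⬝ᵥ x)) • g := by
  ext i
  simp [spike, Matrix.sub_mulVec, Matrix.smul_mulVec, Matrix.vecMulVec_mulVec]
  ring

lemma dotProduct_spike_mulVec (c : ℝ) (g v w : Fin d → ℝ) :
    v ⬝ᵥ (spike c g *ᵥ w) = v ⬝ᵥ w - c * (g ⬝ᵥ v) * (g ⬝ᵥ w) := by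
  rw [spike_mulVec, dotProduct_sub, dotProduct_smul, smul_eq_mul, dotProduct_comm v g]
  ring

lemma spike_isHermitian (c : ℝ) (g : Fin d → ℝ) : (spike c g).IsHermitian := by
  simp [Matrix.IsHermitian, spike, Matrix.transpose_vecMulVec]

lemma spike_mulVec_self (c : ℝ) (g : Fin d → ℝ) :
    spike c g *ᵥ g = -(c * (g ⬝ᵥ g) - 1) • g := by
  rw [spike_mulVec]
  module

/-- The form at x is |Px|² - c⟨Pg, Px⟩², which Cauchy–Schwarz bounds below by (1 - c|Pg|²)|Px|². -/
lemma posSemidef_compression_spike {P : Matrix (Fin d) (Fin d) ℝ} (hP : IsOrthProj P) {c : ℝ}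
    (hc : 0 ≤ c) {g : Fin d → ℝ} (hg : c * (g ⬝ᵥ (P *ᵥ g)) ≤ 1) :
    (P * spike c g * P).PosSemidef := by
  refine .of_dotProduct_mulVec_nonneg ?_ fun x => ?_
  · have := Matrix.isHermitian_conjTranspose_mul_mul P (spike_isHermitian c g)
    rwa [Matrix.conjTranspose_eq_transpose_of_trivial, hP.1] at this
  · rw [star_trivial, ← Matrix.mulVec_mulVec, ← Matrix.mulVec_mulVec,
      ← IsOrthProj.dotProduct_mulVec_comm hP.1, dotProduct_spike_mulVec]
    have h1 : g ⬝ᵥ (P *ᵥ x) = (P *ᵥ g) ⬝ᵥ (P *ᵥ x) := by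
      rw [IsOrthProj.dotProduct_mulVec_comm hP.1, Matrix.mulVec_mulVec, hP.2]
    rw [hP.dotProduct_mulVec_self] at hg
    rw [h1]
    have hcs : ((P *ᵥ g) ⬝ᵥ (P *ᵥ x)) ^ 2 ≤
        ((P *ᵥ g) ⬝ᵥ (P *ᵥ g)) * ((P *ᵥ x) ⬝ᵥ (P *ᵥ x)) := by
      simpa [dotProduct, sq] using
        Finset.sum_mul_sq_le_sq_mul_sq Finset.univ (P *ᵥ g) (P *ᵥ x)
    have h0 : 0 ≤ (P *ᵥ x) ⬝ᵥ (P *ᵥ x) := by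
      simpa [dotProduct] using Finset.sum_nonneg fun i _ => mul_self_nonneg ((P *ᵥ x) i)
    nlinarith [mul_le_mul_of_nonneg_left hcs hc, mul_le_mul_of_nonneg_right hg h0]

/-- The `ℓ_p` norm of a vector with entries in `[-1, 1]`. -/
lemma norm_toLp_le_rpow {p : ℝ≥0∞} (hp : 1 ≤ p) {u : Fin d → ℝ} (hu : ∀ i, |u i| ≤ 1) :
    ‖WithLp.toLp p u‖ ≤ (d : ℝ) ^ (p⁻¹).toReal := by
  rcases eq_or_ne p ∞ with rfl | h
  · rw [PiLp.norm_toLp]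
    simpa using (pi_norm_le_iff_of_nonneg zero_le_one).2 hu
  · have hp0 : 0 < p.toReal := ENNReal.toReal_pos (by positivity) h
    rw [PiLp.norm_eq_sum hp0, ENNReal.toReal_inv, one_div]
    gcongr
    calc ∑ i, ‖u i‖ ^ p.toReal ≤ ∑ _i : Fin d, (1 : ℝ) := by
          gcongr with i
          exact Real.rpow_le_one (norm_nonneg _) (hu i) hp0.le
      _ = d := by simp

/-- An orthonormal eigenbasis of `AᵀA`, whose eigenvalues are the squared singular values. -/
lemma exists_singular_basis (A : Matrix (Fin d) (Fin d) ℝ) :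
    ∃ b : Fin d → (Fin d → ℝ), (∀ i, b i ⬝ᵥ b i = 1) ∧ (∀ i j, i ≠ j → b i ⬝ᵥ b j = 0) ∧
      ∀ i, (Aᵀ * A) *ᵥ b i = ((Matrix.toEuclideanLin A).singularValues i) ^ 2 • b i := by
  set T := Matrix.toEuclideanLin A with hT
  have hn : Module.finrank ℝ (EuclideanSpace ℝ (Fin d)) = d := by simp
  set B := T.isSymmetric_adjoint_comp_self.eigenvectorBasis hn with hB
  have hip : ∀ i j, (B i).ofLp ⬝ᵥ (B j).ofLp = inner ℝ (B i) (B j) := fun i j => by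
    simp [PiLp.inner_apply, dotProduct, mul_comm]
  refine ⟨fun i => (B i).ofLp, fun i => ?_, fun i j hij => ?_, fun i => ?_⟩
  · rw [hip]; simp
  · rw [hip]; exact B.orthonormal.2 hij
  · have h := T.isSymmetric_adjoint_comp_self.apply_eigenvectorBasis hn i
    rw [← T.sq_singularValues_fin hn i, ← hB, LinearMap.comp_apply,
      ← Matrix.toEuclideanLin_conjTranspose_eq_adjoint] at h
    have h2 := congrArg WithLp.ofLp h
    simpa [hT, Matrix.toLpLin_apply, Matrix.mulVec_mulVec] using h2

/-- All singular values are 1 except possibly one, equal to L; the triangle inequality separates it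
from the others. -/
lemma schattenNorm_spike_le {p : ℝ≥0∞} (hp : 1 ≤ p) {c : ℝ} {g : Fin d → ℝ}
    (hL : 0 ≤ c * (g ⬝ᵥ g) - 1) :
    schattenNorm p (spike c g) ≤ (d : ℝ) ^ (p⁻¹).toReal + (c * (g ⬝ᵥ g) - 1) := by
  have : Fact (1 ≤ p) := ⟨hp⟩
  set L := c * (g ⬝ᵥ g) - 1 with hLdef
  obtain ⟨b, hb1, hb0, hb⟩ := exists_singular_basis (spike c g)
  set s : Fin d → ℝ := fun i => (Matrix.toEuclideanLin (spike c g)).singularValues i with hs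
  have hs0 : ∀ i, 0 ≤ s i := fun i => LinearMap.singularValues_nonneg _ _
  -- The square of the spike is I + κ g gᵀ, so a singular vector with s ≠ 1 must be parallel to g.
  set κ : ℝ := c * (L - 1) with hκ
  have hkey : ∀ i, (s i ^ 2 - 1) • b i = (κ * (g ⬝ᵥ b i)) • g := fun i => by
    have h1 : (spike c g)ᵀ = spike c g := by
      simpa using (spike_isHermitian c g).eq
    have h2 := hb i
    rw [h1, ← Matrix.mulVec_mulVec, spike_mulVec, spike_mulVec, dotProduct_sub,
      dotProduct_smul, smul_eq_mul] at h2
    rw [sub_smul, ← h2, one_smul, hκ, hLdef]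
    module
  have hval : ∀ i, s i = 1 ∨ s i = L := fun i => by
    by_cases h : g ⬝ᵥ b i = 0
    · left
      have h1 := congrArg (fun x => b i ⬝ᵥ x) (hkey i)
      simp only [h, dotProduct_smul, hb1, mul_zero, zero_smul, smul_eq_mul, mul_one,
        dotProduct_zero] at h1
      nlinarith [hs0 i, h1]
    · right
      have h1 := congrArg (fun x => g ⬝ᵥ x) (hkey i)
      simp only [dotProduct_smul, smul_eq_mul] at h1
      have h2 : s i ^ 2 - 1 = κ * (g ⬝ᵥ g) := mul_right_cancel₀ h (by linarith)
      have h3 : s i ^ 2 = L ^ 2 := by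
        have : κ * (g ⬝ᵥ g) = (L - 1) * (L + 1) := by rw [hκ, hLdef]; ring
        linarith
      exact (sq_eq_sq₀ (hs0 i) hL).1 h3
  -- Two orthonormal vectors cannot both be parallel to g.
  have huniq : ∀ i j, s i ≠ 1 → s j ≠ 1 → i = j := fun i j hi hj => by
    by_contra hij
    have hne : ∀ i, s i ≠ 1 → s i ^ 2 - 1 ≠ 0 := fun i hi h => hi (by nlinarith [hs0 i])
    have h1 : ((s i ^ 2 - 1) • b i) ⬝ᵥ ((s j ^ 2 - 1) • b j) = 0 := by
      simp [hb0 i j hij]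
    rw [hkey j, dotProduct_smul, smul_dotProduct, dotProduct_comm (b i) g] at h1
    have hz : ∀ i, s i ≠ 1 → κ * (g ⬝ᵥ b i) ≠ 0 := fun i hi h => by
      have h2 := congrArg (fun x => b i ⬝ᵥ x) (hkey i)
      simp only [h, dotProduct_smul, hb1, zero_smul, smul_eq_mul, mul_one,
        dotProduct_zero] at h2
      exact hne i hi h2
    simp only [smul_eq_mul, mul_eq_zero] at h1
    rcases h1 with h1 | h1 | h1
    · rcases h1 with h1 | h1
      · exact hz j hj (by simp [h1])
      · exact hz j hj (by simp [h1])
    · exact hne i hi h1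
    · exact hz i hi (by simp [h1])
  have hsn : schattenNorm p (spike c g) = ‖WithLp.toLp p s‖ := rfl
  rw [hsn]
  by_cases hall : ∀ i, s i = 1
  · have := norm_toLp_le_rpow hp (u := s) (fun i => by simp [hall i])
    linarith
  · push Not at hall
    obtain ⟨i₀, hi₀⟩ := hall
    have hsL : s i₀ = L := (hval i₀).resolve_left hi₀
    have hdec : WithLp.toLp p s =
        WithLp.toLp p (Function.update s i₀ 0) + WithLp.toLp p (Pi.single i₀ L) := by
      ext j
      rcases eq_or_ne j i₀ with rfl | hj
      · simp [hsL]
      · simp [hj]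
    rw [hdec]
    refine (norm_add_le _ _).trans (add_le_add (norm_toLp_le_rpow hp fun j => ?_) ?_)
    · rcases eq_or_ne j i₀ with rfl | hj
      · simp
      · have : s j = 1 := by
          by_contra h
          exact hj (huniq j i₀ h hi₀)
        simp [hj, this]
    · exact ((PiLp.norm_single p (fun _ => ℝ) i₀ L).trans (Real.norm_of_nonneg hL)).le

/-- The witness is the eigenvector g; `hfar` rearranges to ε(d^(1/p) + L) ≤ L. -/
lemma isFarFromPSD_spike {p : ℝ≥0∞} (hp : 1 ≤ p) {c ε : ℝ} {g : Fin d → ℝ} (hε : 0 < ε)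
    (hL : 0 < c * (g ⬝ᵥ g) - 1)
    (hfar : ε * (d : ℝ) ^ (p⁻¹).toReal ≤ (1 - ε) * (c * (g ⬝ᵥ g) - 1)) :
    IsFarFromPSD ε p (spike c g) := by
  have hg : g ≠ 0 := by
    rintro rfl
    simp at hL
    linarith
  have hspec : -(c * (g ⬝ᵥ g) - 1) ∈ spectrum ℝ (spike c g) := by
    rw [← Matrix.spectrum_toLin']
    apply Module.End.HasEigenvalue.mem_spectrum
    refine Module.End.hasEigenvalue_of_hasEigenvector (x := g) ⟨?_, hg⟩
    rw [Module.End.mem_eigenspace_iff, Matrix.toLin'_apply, spike_mulVec_self]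
  refine ⟨fun h0 => ?_, spike_isHermitian c g, ?_⟩
  · have h1 := spike_mulVec_self c g
    rw [h0, Matrix.zero_mulVec] at h1
    rcases smul_eq_zero.1 h1.symm with h | h
    · linarith
    · exact hg h
  · rw [(spike_isHermitian c g).spectrum_real_eq_range_eigenvalues] at hspec
    obtain ⟨i, hi⟩ := hspec
    refine ⟨i, hi.trans_le ?_⟩
    have := mul_le_mul_of_nonneg_left (schattenNorm_spike_le hp hL.le) hε.le
    linarith

end Spike

/-! ### Gaussian vectors: resampling, quadratic forms, length. -/

section Gaussian

open ProbabilityTheory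

/-- The law of a vector with independent standard Gaussian coordinates. -/
noncomputable abbrev gaussianVec (d : ℕ) : Measure (Fin d → ℝ) :=
  Measure.pi fun _ => gaussianReal 0 1

variable {d : ℕ}

/-- Resampling the component of a Gaussian vector orthogonal to a fixed subspace. -/
lemma map_resample_gaussianVec {P : Matrix (Fin d) (Fin d) ℝ} (hP : IsOrthProj P) :
    ((gaussianVec d).prod (gaussianVec d)).map (fun z => P *ᵥ z.1 + (1 - P) *ᵥ z.2) =
      gaussianVec d := by
  have hmeas : Measurable fun z : (Fin d → ℝ) × (Fin d → ℝ) => P *ᵥ z.1 + (1 - P) *ᵥ z.2 := by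
    fun_prop
  have hto : Measurable (WithLp.toLp 2 : (Fin d → ℝ) → EuclideanSpace ℝ (Fin d)) := by
    fun_prop
  apply (MeasurableEquiv.toLp 2 (Fin d → ℝ)).map_measurableEquiv_injective
  change Measure.map (WithLp.toLp 2) _ = Measure.map (WithLp.toLp 2) _
  apply Measure.ext_of_charFun (E := EuclideanSpace ℝ (Fin d))
  ext t
  rw [map_pi_eq_stdGaussian, Measure.map_map hto hmeas, charFun_apply,
    integral_map (by fun_prop) (by fun_prop)]
  have hsplit : ∀ z : (Fin d → ℝ) × (Fin d → ℝ),
      inner ℝ (WithLp.toLp 2 (P *ᵥ z.1 + (1 - P) *ᵥ z.2) : EuclideanSpace ℝ (Fin d)) t =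
        inner ℝ (WithLp.toLp 2 z.1 : EuclideanSpace ℝ (Fin d)) (WithLp.toLp 2 (P *ᵥ t.ofLp)) +
        inner ℝ (WithLp.toLp 2 z.2 : EuclideanSpace ℝ (Fin d))
          (WithLp.toLp 2 ((1 - P) *ᵥ t.ofLp)) := fun z => by
    have hQ : (1 - P)ᵀ = 1 - P := by simp [hP.1]
    have h1 := IsOrthProj.dotProduct_mulVec_comm hP.1 z.1 t.ofLp
    have h2 := IsOrthProj.dotProduct_mulVec_comm hQ z.2 t.ofLp
    have hi : ∀ (x : Fin d → ℝ) (s : EuclideanSpace ℝ (Fin d)),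
        inner ℝ (WithLp.toLp 2 x : EuclideanSpace ℝ (Fin d)) s = x ⬝ᵥ s.ofLp := fun x s => by
      simp [PiLp.inner_apply, dotProduct, mul_comm]
    rw [hi, hi, hi, add_dotProduct, h1, h2]
  -- By Pythagoras, the exponents of the two independent characteristic functions add up to that of
  -- one Gaussian.
  have hnorm : ‖(WithLp.toLp 2 (P *ᵥ t.ofLp) : EuclideanSpace ℝ (Fin d))‖ ^ 2 +
      ‖(WithLp.toLp 2 ((1 - P) *ᵥ t.ofLp) : EuclideanSpace ℝ (Fin d))‖ ^ 2 = ‖t‖ ^ 2 := by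
    have hn : ∀ x : Fin d → ℝ, ‖(WithLp.toLp 2 x : EuclideanSpace ℝ (Fin d))‖ ^ 2 = x ⬝ᵥ x :=
      fun x => by rw [EuclideanSpace.real_norm_sq_eq]; simp [dotProduct, sq]
    have h0 := hP.dotProduct_mulVec_self t.ofLp
    have h1 := dotProduct_comm (P *ᵥ t.ofLp) t.ofLp
    have ht : ‖t‖ ^ 2 = t.ofLp ⬝ᵥ t.ofLp := hn t.ofLp
    rw [hn, hn, ht, Matrix.sub_mulVec, Matrix.one_mulVec]
    simp only [dotProduct_sub, sub_dotProduct]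
    linarith
  have hfac : ∀ s : EuclideanSpace ℝ (Fin d),
      ∫ x, Complex.exp ((inner ℝ (WithLp.toLp 2 x : EuclideanSpace ℝ (Fin d)) s : ℝ) * Complex.I)
        ∂(gaussianVec d) = Complex.exp (-‖s‖ ^ 2 / 2) := fun s => by
    rw [← charFun_stdGaussian, charFun_apply, ← map_pi_eq_stdGaussian,
      integral_map (by fun_prop) (by fun_prop)]
  simp only [Function.comp_apply, hsplit, Complex.ofReal_add, add_mul, Complex.exp_add]
  rw [integral_prod_mul (μ := gaussianVec d) (ν := gaussianVec d)
    (fun x : Fin d → ℝ => Complex.exp ((inner ℝ (WithLp.toLp 2 x : EuclideanSpace ℝ (Fin d))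
      (WithLp.toLp 2 (P *ᵥ t.ofLp)) : ℝ) * Complex.I))
    (fun x : Fin d → ℝ => Complex.exp ((inner ℝ (WithLp.toLp 2 x : EuclideanSpace ℝ (Fin d))
      (WithLp.toLp 2 ((1 - P) *ᵥ t.ofLp)) : ℝ) * Complex.I)), hfac, hfac, ← Complex.exp_add,
    charFun_stdGaussian]
  congr 1
  rw [← Complex.ofReal_pow, ← Complex.ofReal_pow, ← Complex.ofReal_pow, ← hnorm]
  push_cast
  ring

lemma lintegral_resample_gaussianVec {P : Matrix (Fin d) (Fin d) ℝ} (hP : IsOrthProj P)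
    {f : (Fin d → ℝ) → ℝ≥0∞} (hf : Measurable f) :
    ∫⁻ x, f x ∂(gaussianVec d) =
      ∫⁻ x, ∫⁻ y, f (P *ᵥ x + (1 - P) *ᵥ y) ∂(gaussianVec d) ∂(gaussianVec d) := by
  conv_lhs => rw [← map_resample_gaussianVec hP]
  rw [lintegral_map hf (by fun_prop), lintegral_prod _ (by fun_prop)]

lemma memLp_eval_gaussianVec (i : Fin d) : MemLp (fun x => x i) 2 (gaussianVec d) :=
  (memLp_id_gaussianReal 2).comp_measurePreserving
    (measurePreserving_eval (fun _ : Fin d => gaussianReal 0 1) i)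

lemma integral_mul_gaussianVec (i j : Fin d) :
    ∫ x, x i * x j ∂(gaussianVec d) = (1 : Matrix (Fin d) (Fin d) ℝ) i j := by
  have h := covariance_eval_multivariateGaussian (μ := 0)
    (Matrix.PosSemidef.one (n := Fin d) (R := ℝ)) i j
  have h0 : ∀ i : Fin d, ∫ x, x i ∂(gaussianVec d) = 0 := fun i => by
    rw [integral_comp_eval (μ := fun _ : Fin d => gaussianReal 0 1) (i := i) (f := fun x => x)
      (by fun_prop)]
    simp
  rw [multivariateGaussian_zero_one, ← map_pi_eq_stdGaussian, covariance_map_fun (by fun_prop)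
    (by fun_prop) (by fun_prop), covariance_eq_sub (memLp_eval_gaussianVec i)
    (memLp_eval_gaussianVec j)] at h
  simpa [h0] using h

/-- The expectation of a positive semidefinite quadratic form in a Gaussian vector. -/
lemma lintegral_quadratic_gaussianVec {M : Matrix (Fin d) (Fin d) ℝ}
    (hM : ∀ x, 0 ≤ x ⬝ᵥ (M *ᵥ x)) :
    ∫⁻ x, ENNReal.ofReal (x ⬝ᵥ (M *ᵥ x)) ∂(gaussianVec d) = ENNReal.ofReal M.trace := by
  have hexp : ∀ x : Fin d → ℝ, x ⬝ᵥ (M *ᵥ x) = ∑ i, ∑ j, M i j * (x i * x j) := fun x => by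
    simp only [dotProduct, Matrix.mulVec, Finset.mul_sum]
    exact Finset.sum_congr rfl fun i _ => Finset.sum_congr rfl fun j _ => by ring
  have hint : ∀ i j, Integrable (fun x : Fin d → ℝ => M i j * (x i * x j)) (gaussianVec d) :=
    fun i j => ((memLp_eval_gaussianVec i).integrable_mul (memLp_eval_gaussianVec j)).const_mul _
  have hint' : Integrable (fun x : Fin d → ℝ => x ⬝ᵥ (M *ᵥ x)) (gaussianVec d) := by
    simp only [hexp]
    exact integrable_finsetSum _ fun i _ => integrable_finsetSum _ fun j _ => hint i j
  rw [← ofReal_integral_eq_lintegral_ofReal hint' (ae_of_all _ hM)]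
  congr 1
  simp only [hexp]
  rw [integral_finsetSum _ fun i _ => integrable_finsetSum _ fun j _ => hint i j]
  simp_rw [integral_finsetSum _ fun j _ => hint _ j, integral_const_mul, integral_mul_gaussianVec]
  simp [Matrix.one_apply, Matrix.trace]

/-- A Gaussian vector has squared length at least of the order of the dimension, with constant
probability. -/
lemma exists_small_ball_gaussianVec :
    ∃ β : ℝ, 0 < β ∧ ∀ d : ℕ, 1 ≤ d →
      ENNReal.ofReal β ≤ gaussianVec d {g | β * d ≤ g ⬝ᵥ g} := by
  -- Truncating at 1 bounds the sum by d, so its mean κd alone forces it above κd/2 with probability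
  -- at least κ/2; no concentration is needed.
  set m : ℝ → ℝ := fun x => min (x ^ 2) 1 with hm
  have hm0 : ∀ x, 0 ≤ m x := fun x => le_min (sq_nonneg x) zero_le_one
  have hm1 : ∀ x, m x ≤ 1 := fun x => min_le_right _ _
  have hmm : Measurable m := by fun_prop
  have hmi : Integrable m (gaussianReal 0 1) :=
    .of_bound hmm.aestronglyMeasurable 1 (ae_of_all _ fun x => by
      rw [Real.norm_of_nonneg (hm0 x)]; exact hm1 x)
  set κ : ℝ := ∫ x, m x ∂(gaussianReal 0 1) with hκ
  have hκ0 : 0 < κ := by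
    rw [hκ, integral_pos_iff_support_of_nonneg hm0 hmi]
    have hs : Function.support m = {0}ᶜ := by
      ext x
      simp only [Function.mem_support, hm, Set.mem_compl_iff, Set.mem_singleton_iff]
      refine not_congr ⟨fun h => ?_, fun h => by simp [h]⟩
      by_contra hx
      have : 0 < min (x ^ 2) 1 := lt_min (by positivity) one_pos
      linarith
    have hna := nullSingletonClass_gaussianReal (μ := 0) (v := 1) one_ne_zero
    rw [hs, measure_compl (measurableSet_singleton _) (by simp)]
    simp
  refine ⟨κ / 2, by positivity, fun d hd => ?_⟩
  have hd0 : (0 : ℝ) < d := by exact_mod_cast hd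
  set S : (Fin d → ℝ) → ℝ := fun g => ∑ i, m (g i) with hS
  have hSle : ∀ g, S g ≤ g ⬝ᵥ g := fun g =>
    Finset.sum_le_sum fun i _ => (min_le_left _ _).trans (sq (g i)).le
  have hSd : ∀ g, S g ≤ d := fun g =>
    (Finset.sum_le_sum fun i _ => hm1 (g i)).trans (by simp)
  have hSm : Measurable S := by fun_prop
  have hie : ∀ i : Fin d, Integrable (fun g : Fin d → ℝ => m (g i)) (gaussianVec d) := fun i =>
    integrable_comp_eval (μ := fun _ : Fin d => gaussianReal 0 1) hmi
  have hSi : Integrable S (gaussianVec d) := integrable_finsetSum _ fun i _ => hie i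
  have hSint : ∫ g, S g ∂(gaussianVec d) = d * κ := by
    rw [hS, integral_finsetSum _ fun i _ => hie i]
    simp_rw [integral_comp_eval (μ := fun _ : Fin d => gaussianReal 0 1) (f := m)
      hmm.aestronglyMeasurable]
    simp [hκ]
  set B : Set (Fin d → ℝ) := {g | κ / 2 * d ≤ S g} with hB
  have hBm : MeasurableSet B := measurableSet_le (by fun_prop) hSm
  have hpt : ∀ g, S g ≤ B.indicator (fun _ => (d : ℝ)) g + κ / 2 * d := fun g => by
    by_cases hg : g ∈ B
    · rw [Set.indicator_of_mem hg]
      have := hSd g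
      have : 0 < κ / 2 * d := by positivity
      linarith
    · rw [Set.indicator_of_notMem hg, zero_add]
      exact (not_le.1 hg).le
  have hle := integral_mono hSi
    (((integrable_const (d : ℝ)).indicator hBm).add (integrable_const (κ / 2 * d))) hpt
  simp only [Pi.add_apply] at hle
  rw [integral_add ((integrable_const (d : ℝ)).indicator hBm) (integrable_const _),
    integral_indicator_const _ hBm, hSint, integral_const] at hle
  simp only [smul_eq_mul, probReal_univ, one_mul] at hle
  have hB2 : κ / 2 ≤ (gaussianVec d).real B := by
    by_contra h
    push Not at h
    have := mul_lt_mul_of_pos_right h hd0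
    linarith
  calc ENNReal.ofReal (κ / 2) ≤ ENNReal.ofReal ((gaussianVec d).real B) :=
        ENNReal.ofReal_le_ofReal hB2
    _ = gaussianVec d B := ofReal_measureReal
    _ ≤ _ := measure_mono fun g hg => le_trans hg (hSle g)

end Gaussian

/-! ### Measurability of the linear algebra. -/

section Measurability

variable {d : ℕ} {α : Type*} [MeasurableSpace α]

lemma measurable_mulVec {P : α → Matrix (Fin d) (Fin d) ℝ} {v : α → Fin d → ℝ}
    (hP : ∀ i j, Measurable fun a => P a i j) (hv : Measurable v) :
    Measurable fun a => P a *ᵥ v a :=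
  measurable_pi_lambda _ fun i => by
    simp only [Matrix.mulVec, dotProduct]
    exact Finset.measurable_sum _ fun j _ => (hP i j).mul ((measurable_pi_apply j).comp hv)

lemma measurable_dotProduct {v w : α → Fin d → ℝ} (hv : Measurable v) (hw : Measurable w) :
    Measurable fun a => v a ⬝ᵥ w a := by
  simp only [dotProduct]
  exact Finset.measurable_sum _ fun j _ =>
    ((measurable_pi_apply j).comp hv).mul ((measurable_pi_apply j).comp hw)

lemma measurable_one_sub_apply {P : α → Matrix (Fin d) (Fin d) ℝ}
    (hP : ∀ i j, Measurable fun a => P a i j) (i j : Fin d) :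
    Measurable fun a => (1 - P a) i j := by
  simp only [Matrix.sub_apply]
  exact measurable_const.sub (hP i j)

lemma measurable_extendProj {P : α → Matrix (Fin d) (Fin d) ℝ} {v : α → Fin d → ℝ}
    (hP : ∀ i j, Measurable fun a => P a i j) (hv : Measurable v) (i j : Fin d) :
    Measurable fun a => extendProj (P a) (v a) i j := by
  have hr : Measurable fun a => residual (P a) (v a) := hv.sub (measurable_mulVec hP hv)
  have hri : ∀ i, Measurable fun a => residual (P a) (v a) i := fun i =>
    (measurable_pi_apply i).comp hr
  simp only [extendProj, Matrix.add_apply, Matrix.smul_apply, Matrix.vecMulVec_apply, smul_eq_mul]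
  exact (hP i j).add ((measurable_dotProduct hr hr).inv.mul ((hri i).mul (hri j)))

lemma measurable_snoc {k : ℕ} {a : α → Fin k → ℝ} {x : α → ℝ} (ha : Measurable a)
    (hx : Measurable x) :
    Measurable fun z => (Fin.snoc (α := fun _ => ℝ) (a z) (x z) : Fin (k + 1) → ℝ) :=
  measurable_pi_lambda _ fun i => by
    refine Fin.lastCases ?_ (fun i => ?_) i
    · simpa using hx
    · simpa [Function.comp_def] using (measurable_pi_apply i).comp ha

end Measurability

/-! ### The revealed subspace and the conditional law of the spike. -/

namespace AdaptiveVMV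

variable {d q : ℕ} {Ω : Type*} [MeasurableSpace Ω]

/-- The projection onto the span of the vectors in the first `k` queries, as a function of the
answers to them. -/
noncomputable def revealed (T : AdaptiveVMV d q Ω) (ω : Ω) :
    (k : ℕ) → (Fin k → ℝ) → Matrix (Fin d) (Fin d) ℝ
  | 0, _ => 0
  | k + 1, a =>
    extendProj (extendProj (revealed T ω k (Fin.init a)) (T.query k (ω, Fin.init a)).1)
      (T.query k (ω, Fin.init a)).2

/-- The projection onto the span of the vectors in the first `k + 1` queries, as a function of the
answers to the first `k`. -/
noncomputable def nextRevealed (T : AdaptiveVMV d q Ω) (ω : Ω) (k : ℕ) (a : Fin k → ℝ) :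
    Matrix (Fin d) (Fin d) ℝ :=
  extendProj (extendProj (T.revealed ω k a) (T.query k (ω, a)).1) (T.query k (ω, a)).2

/-- The answers to the first `k + 1` queries, given those to the first `k`. -/
def nextAnswers (T : AdaptiveVMV d q Ω) (A : Matrix (Fin d) (Fin d) ℝ) (ω : Ω) (k : ℕ)
    (a : Fin k → ℝ) : Fin (k + 1) → ℝ :=
  Fin.snoc (α := fun _ => ℝ) a ((T.query k (ω, a)).1 ⬝ᵥ (A *ᵥ (T.query k (ω, a)).2))

variable (T : AdaptiveVMV d q Ω) (ω : Ω)

lemma answers_succ (A : Matrix (Fin d) (Fin d) ℝ) (k : ℕ) :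
    T.answers A ω (k + 1) = T.nextAnswers A ω k (T.answers A ω k) := rfl

/-- Predictability: the subspace is fixed before the newest answer arrives, so it can be treated as
constant when the hidden part is resampled. -/
lemma revealed_nextAnswers (A : Matrix (Fin d) (Fin d) ℝ) (k : ℕ) (a : Fin k → ℝ) :
    T.revealed ω (k + 1) (T.nextAnswers A ω k a) = T.nextRevealed ω k a := by
  simp only [revealed, nextRevealed, nextAnswers, Fin.init_snoc]

lemma isOrthProj_revealed (k : ℕ) (a : Fin k → ℝ) : IsOrthProj (T.revealed ω k a) := by
  induction k with
  | zero => exact IsOrthProj.zero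
  | succ k ih => exact ((ih _).extendProj _).extendProj _

lemma isOrthProj_nextRevealed (k : ℕ) (a : Fin k → ℝ) : IsOrthProj (T.nextRevealed ω k a) :=
  ((T.isOrthProj_revealed ω k a).extendProj _).extendProj _

lemma nextRevealed_mul_revealed (k : ℕ) (a : Fin k → ℝ) :
    T.nextRevealed ω k a * T.revealed ω k a = T.revealed ω k a := by
  have hU := T.isOrthProj_revealed ω k a
  have h1 := hU.extendProj_mul (T.query k (ω, a)).1
  rw [nextRevealed]
  conv_lhs => enter [2]; rw [← h1]
  rw [← Matrix.mul_assoc, (hU.extendProj _).extendProj_mul, h1]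

lemma nextRevealed_mulVec_fst (k : ℕ) (a : Fin k → ℝ) :
    T.nextRevealed ω k a *ᵥ (T.query k (ω, a)).1 = (T.query k (ω, a)).1 := by
  have hU := T.isOrthProj_revealed ω k a
  have h1 := hU.extendProj_mulVec (T.query k (ω, a)).1
  rw [nextRevealed]
  conv_lhs => enter [2]; rw [← h1]
  rw [Matrix.mulVec_mulVec, (hU.extendProj _).extendProj_mul, h1]

lemma nextRevealed_mulVec_snd (k : ℕ) (a : Fin k → ℝ) :
    T.nextRevealed ω k a *ᵥ (T.query k (ω, a)).2 = (T.query k (ω, a)).2 :=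
  ((T.isOrthProj_revealed ω k a).extendProj _).extendProj_mulVec _

lemma trace_nextRevealed_le (k : ℕ) (a : Fin k → ℝ) :
    (T.nextRevealed ω k a).trace ≤ (T.revealed ω k a).trace + 2 := by
  have h1 := trace_extendProj_le (T.revealed ω k a) (T.query k (ω, a)).1
  have h2 := trace_extendProj_le (extendProj (T.revealed ω k a) (T.query k (ω, a)).1)
    (T.query k (ω, a)).2
  rw [nextRevealed]
  linarith

lemma revealed_mul_revealed (A : Matrix (Fin d) (Fin d) ℝ) {k m : ℕ} (h : k ≤ m) :
    T.revealed ω m (T.answers A ω m) * T.revealed ω k (T.answers A ω k) =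
      T.revealed ω k (T.answers A ω k) := by
  induction m, h using Nat.le_induction with
  | base => exact (T.isOrthProj_revealed ω k _).2
  | succ m _ ih =>
    rw [answers_succ, revealed_nextAnswers, ← ih, ← Matrix.mul_assoc, nextRevealed_mul_revealed]

lemma revealed_mulVec_of_nextRevealed (A : Matrix (Fin d) (Fin d) ℝ) {k m : ℕ} (h : k < m)
    {v : Fin d → ℝ} (hv : T.nextRevealed ω k (T.answers A ω k) *ᵥ v = v) :
    T.revealed ω m (T.answers A ω m) *ᵥ v = v := by
  have h1 := T.revealed_mul_revealed ω A h
  rw [answers_succ, revealed_nextAnswers] at h1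
  conv_lhs => rw [← hv]
  rw [Matrix.mulVec_mulVec, h1, hv]

/-- The queries do not distinguish `A` from its compression to the span of their vectors. -/
lemma answers_compression (A : Matrix (Fin d) (Fin d) ℝ) (m : ℕ) {k : ℕ} (hk : k ≤ m) :
    T.answers (T.revealed ω m (T.answers A ω m) * A * T.revealed ω m (T.answers A ω m)) ω k =
      T.answers A ω k := by
  induction k with
  | zero => rfl
  | succ k ih =>
    rw [answers_succ, answers_succ, ih (by omega)]
    simp only [nextAnswers]
    congr 1
    have hP := T.isOrthProj_revealed ω m (T.answers A ω m)
    rw [← Matrix.mulVec_mulVec, ← Matrix.mulVec_mulVec,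
      ← IsOrthProj.dotProduct_mulVec_comm hP.1,
      T.revealed_mulVec_of_nextRevealed ω A hk (T.nextRevealed_mulVec_fst ω k _),
      T.revealed_mulVec_of_nextRevealed ω A hk (T.nextRevealed_mulVec_snd ω k _)]

/-- A one-sided algorithm accepts every spiked matrix whose spike it has not located. -/
lemma IsOneSided.run_spike_eq_true {T : AdaptiveVMV d q Ω} (hT : T.IsOneSided) (ω : Ω) {c : ℝ}
    (hc : 0 ≤ c) {g : Fin d → ℝ}
    (hg : c * (g ⬝ᵥ (T.revealed ω q (T.answers (spike c g) ω q) *ᵥ g)) ≤ 1) :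
    T.run (spike c g) ω = true := by
  have h := hT ω _ (posSemidef_compression_spike (T.isOrthProj_revealed ω q _) hc hg)
  rwa [run, T.answers_compression ω (spike c g) q le_rfl] at h

lemma measurable_revealed (k : ℕ) (i j : Fin d) :
    Measurable fun a => T.revealed ω k a i j := by
  induction k generalizing i j with
  | zero => simp only [revealed]; exact measurable_const
  | succ k ih =>
    have hinit : Measurable fun a : Fin (k + 1) → ℝ => (Fin.init a : Fin k → ℝ) :=
      measurable_pi_lambda _ fun i => measurable_pi_apply _
    have hq : Measurable fun a : Fin (k + 1) → ℝ => T.query k (ω, Fin.init a) :=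
      (T.measurable_query k).comp (measurable_const.prodMk hinit)
    simp only [revealed]
    exact measurable_extendProj
      (measurable_extendProj (fun i j => (ih i j).comp hinit) hq.fst) hq.snd i j

lemma measurable_nextRevealed (k : ℕ) (i j : Fin d) :
    Measurable fun a => T.nextRevealed ω k a i j := by
  have hq : Measurable fun a : Fin k → ℝ => T.query k (ω, a) :=
    (T.measurable_query k).comp (measurable_const.prodMk measurable_id)
  exact measurable_extendProj (measurable_extendProj (T.measurable_revealed ω k) hq.fst) hq.snd i j

lemma measurable_nextAnswers_spike {α : Type*} [MeasurableSpace α] (c : ℝ) (k : ℕ) {w : α → Ω}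
    {a : α → Fin k → ℝ} {g : α → Fin d → ℝ} (hw : Measurable w) (ha : Measurable a)
    (hg : Measurable g) :
    Measurable fun z => T.nextAnswers (spike c (g z)) (w z) k (a z) := by
  have hq : Measurable fun z => T.query k (w z, a z) :=
    (T.measurable_query k).comp (hw.prodMk ha)
  simp only [nextAnswers, dotProduct_spike_mulVec]
  exact measurable_snoc ha (((measurable_dotProduct hq.fst hq.snd)).sub
    ((measurable_const.mul (measurable_dotProduct hg hq.fst)).mul
      (measurable_dotProduct hg hq.snd)))

lemma measurable_answers_spike {α : Type*} [MeasurableSpace α] (c : ℝ) (k : ℕ) {w : α → Ω}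
    {g : α → Fin d → ℝ} (hw : Measurable w) (hg : Measurable g) :
    Measurable fun z => T.answers (spike c (g z)) (w z) k := by
  induction k with
  | zero => exact measurable_pi_lambda _ fun i => i.elim0
  | succ k ih => exact T.measurable_nextAnswers_spike c k hw ih hg

/-- The next answer on a spiked matrix only depends on the revealed part of the spike. -/
lemma nextAnswers_spike_congr (c : ℝ) (k : ℕ) (a : Fin k → ℝ) {x y : Fin d → ℝ}
    (h : T.nextRevealed ω k a *ᵥ x = T.nextRevealed ω k a *ᵥ y) :
    T.nextAnswers (spike c x) ω k a = T.nextAnswers (spike c y) ω k a := by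
  have hV := (T.isOrthProj_nextRevealed ω k a).1
  have key : ∀ v, T.nextRevealed ω k a *ᵥ v = v → x ⬝ᵥ v = y ⬝ᵥ v := fun v hv => by
    rw [← hv, ← IsOrthProj.dotProduct_mulVec_comm hV, ← IsOrthProj.dotProduct_mulVec_comm hV, h]
  simp only [nextAnswers, dotProduct_spike_mulVec, key _ (T.nextRevealed_mulVec_fst ω k a),
    key _ (T.nextRevealed_mulVec_snd ω k a)]

variable {T ω} in
lemma nextRevealed_mulVec_resample {k : ℕ} {a : Fin k → ℝ} (x y : Fin d → ℝ) :
    T.nextRevealed ω k a *ᵥ (T.nextRevealed ω k a *ᵥ x + (1 - T.nextRevealed ω k a) *ᵥ y) =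
      T.nextRevealed ω k a *ᵥ x := by
  have hV := (T.isOrthProj_nextRevealed ω k a).2
  rw [Matrix.mulVec_add, Matrix.mulVec_mulVec, Matrix.mulVec_mulVec, Matrix.mul_sub, hV]
  simp

/-- Given the answers, the part of the spike that is orthogonal to all query vectors can be
resampled. -/
theorem lintegral_resample_answers (c : ℝ) (k : ℕ)
    {F : (Fin k → ℝ) × (Fin d → ℝ) → ℝ≥0∞} (hF : Measurable F) :
    ∫⁻ g, F (T.answers (spike c g) ω k, g) ∂(gaussianVec d) =
      ∫⁻ g, ∫⁻ y, F (T.answers (spike c g) ω k,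
        T.revealed ω k (T.answers (spike c g) ω k) *ᵥ g +
          (1 - T.revealed ω k (T.answers (spike c g) ω k)) *ᵥ y)
        ∂(gaussianVec d) ∂(gaussianVec d) := by
  induction k with
  | zero => simp [revealed, answers]
  | succ k ih =>
    set U := T.revealed ω k with hU
    set V := T.nextRevealed ω k with hV
    have hF1 : Measurable fun z : (Fin k → ℝ) × (Fin d → ℝ) =>
        F (T.nextAnswers (spike c z.2) ω k z.1, z.2) :=
      hF.comp ((T.measurable_nextAnswers_spike c k measurable_const measurable_fst
        measurable_snd).prodMk measurable_snd)
    have hVm : ∀ i j, Measurable fun z : ((Fin k → ℝ) × (Fin d → ℝ)) × (Fin d → ℝ) =>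
        V z.1.1 i j := fun i j => (T.measurable_nextRevealed ω k i j).comp (by fun_prop)
    have hF2 : Measurable fun z : (Fin k → ℝ) × (Fin d → ℝ) =>
        ∫⁻ y, F (T.nextAnswers (spike c z.2) ω k z.1, V z.1 *ᵥ z.2 + (1 - V z.1) *ᵥ y)
          ∂(gaussianVec d) := by
      refine Measurable.lintegral_prod_right' (f := fun z : ((Fin k → ℝ) × (Fin d → ℝ)) ×
        (Fin d → ℝ) => F (T.nextAnswers (spike c z.1.2) ω k z.1.1,
          V z.1.1 *ᵥ z.1.2 + (1 - V z.1.1) *ᵥ z.2)) ?_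
      refine hF.comp (Measurable.prodMk ?_ ?_)
      · exact T.measurable_nextAnswers_spike c k measurable_const (by fun_prop) (by fun_prop)
      · exact (measurable_mulVec hVm (by fun_prop)).add
          (measurable_mulVec (measurable_one_sub_apply hVm) (by fun_prop))
    simp only [answers_succ, revealed_nextAnswers]
    -- Both sides are resampled given the first k answers, leaving an identity for each fixed g.
    rw [ih hF1, ih hF2]
    refine lintegral_congr fun g => ?_
    set a := T.answers (spike c g) ω k with ha
    have hUV : U a * V a = U a := by
      have h := congrArg Matrix.transpose (T.nextRevealed_mul_revealed ω k a)
      rwa [Matrix.transpose_mul, (T.isOrthProj_revealed ω k a).1,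
        (T.isOrthProj_nextRevealed ω k a).1] at h
    have hVU : V a * U a = U a := T.nextRevealed_mul_revealed ω k a
    have hm : Measurable fun y : Fin d → ℝ =>
        F (T.nextAnswers (spike c (U a *ᵥ g + (1 - U a) *ᵥ y)) ω k a,
          U a *ᵥ g + (1 - U a) *ᵥ y) :=
      hF1.comp (g := fun z : (Fin k → ℝ) × (Fin d → ℝ) =>
        F (T.nextAnswers (spike c z.2) ω k z.1, z.2))
        (f := fun y : Fin d → ℝ => (a, U a *ᵥ g + (1 - U a) *ᵥ y)) (by fun_prop)
    rw [lintegral_resample_gaussianVec (T.isOrthProj_nextRevealed ω k a) hm]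
    refine lintegral_congr fun y => lintegral_congr fun y' => ?_
    -- Resampling outside V inside a resampling outside U amounts to resampling outside V directly,
    -- because the range of U lies in that of V. The V-part is unchanged, hence so is the next
    -- answer.
    have hz : U a *ᵥ g + (1 - U a) *ᵥ (V a *ᵥ y + (1 - V a) *ᵥ y') =
        V a *ᵥ (U a *ᵥ g + (1 - U a) *ᵥ y) + (1 - V a) *ᵥ y' := by
      simp only [Matrix.mulVec_add, Matrix.mulVec_mulVec, Matrix.sub_mul, Matrix.mul_sub,
        Matrix.one_mul, Matrix.mul_one, hUV, hVU]
      rw [← add_assoc, show 1 - U a - (V a - U a) = 1 - V a by abel]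
    rw [← hV, hz, T.nextAnswers_spike_congr ω c k a (nextRevealed_mulVec_resample _ _)]

/-- However adaptive, `k` queries reveal at most `2 k` dimensions' worth of the spike. -/
theorem lintegral_revealed_le (c : ℝ) (k : ℕ) :
    ∫⁻ g, ENNReal.ofReal (g ⬝ᵥ (T.revealed ω k (T.answers (spike c g) ω k) *ᵥ g))
      ∂(gaussianVec d) ≤ 2 * k := by
  induction k with
  | zero => simp [revealed]
  | succ k ih =>
    simp only [answers_succ, revealed_nextAnswers]
    have hFm : Measurable fun z : (Fin k → ℝ) × (Fin d → ℝ) =>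
        ENNReal.ofReal (z.2 ⬝ᵥ (T.nextRevealed ω k z.1 *ᵥ z.2)) := by
      refine (measurable_dotProduct measurable_snd (measurable_mulVec (fun i j => ?_)
        measurable_snd)).ennreal_ofReal
      exact (T.measurable_nextRevealed ω k i j).comp measurable_fst
    rw [T.lintegral_resample_answers ω c k hFm]
    have hstep : ∀ g, ∫⁻ y, ENNReal.ofReal
        ((T.revealed ω k (T.answers (spike c g) ω k) *ᵥ g +
          (1 - T.revealed ω k (T.answers (spike c g) ω k)) *ᵥ y) ⬝ᵥ
          (T.nextRevealed ω k (T.answers (spike c g) ω k) *ᵥ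
          (T.revealed ω k (T.answers (spike c g) ω k) *ᵥ g +
          (1 - T.revealed ω k (T.answers (spike c g) ω k)) *ᵥ y))) ∂(gaussianVec d) ≤
        ENNReal.ofReal (g ⬝ᵥ (T.revealed ω k (T.answers (spike c g) ω k) *ᵥ g)) + 2 := by
      intro g
      set a := T.answers (spike c g) ω k
      have htr := T.trace_nextRevealed_le ω k a
      have hVU := T.nextRevealed_mul_revealed ω k a
      have hU := T.isOrthProj_revealed ω k a
      have hV := T.isOrthProj_nextRevealed ω k a
      set U := T.revealed ω k a
      set V := T.nextRevealed ω k a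
      have hUV : U * V = U := by
        have h := congrArg Matrix.transpose hVU
        rwa [Matrix.transpose_mul, hU.1, hV.1] at h
      -- The newly revealed directions: a projection of trace at most 2, fixed given the answers and
      -- applied to a fresh Gaussian.
      have hD : IsOrthProj (V - U) := by
        refine ⟨by simp [hU.1, hV.1], ?_⟩
        simp [Matrix.sub_mul, Matrix.mul_sub, hU.2, hV.2, hUV, hVU]
      have hnn : ∀ {P : Matrix (Fin d) (Fin d) ℝ}, IsOrthProj P → ∀ x, 0 ≤ x ⬝ᵥ (P *ᵥ x) :=
        fun {P} hP x => by
          rw [hP.dotProduct_mulVec_self]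
          exact Finset.sum_nonneg fun i _ => mul_self_nonneg ((P *ᵥ x) i)
      -- The old and new revealed parts are orthogonal, so there is no cross term.
      have hquad : ∀ y, (U *ᵥ g + (1 - U) *ᵥ y) ⬝ᵥ (V *ᵥ (U *ᵥ g + (1 - U) *ᵥ y)) =
          g ⬝ᵥ (U *ᵥ g) + y ⬝ᵥ ((V - U) *ᵥ y) := fun y => by
        set z := U *ᵥ g + (1 - U) *ᵥ y with hz
        have h1 : U *ᵥ z = U *ᵥ g := by
          simp [hz, Matrix.mulVec_add, Matrix.mulVec_mulVec, Matrix.mul_sub, hU.2]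
        have h2 : (V - U) *ᵥ z = (V - U) *ᵥ y := by
          simp [hz, Matrix.mulVec_add, Matrix.mulVec_mulVec, Matrix.mul_sub, Matrix.sub_mul,
            hU.2, hVU]
        have h3 : V *ᵥ z = U *ᵥ g + (V - U) *ᵥ y := by
          rw [← h1, ← h2, ← Matrix.add_mulVec, add_sub_cancel]
        rw [h3, dotProduct_add, ← IsOrthProj.dotProduct_mulVec_comm hU.1,
          ← IsOrthProj.dotProduct_mulVec_comm hD.1, h1, h2, dotProduct_comm,
          dotProduct_comm _ y]
      calc _ = ∫⁻ y, (ENNReal.ofReal (g ⬝ᵥ (U *ᵥ g)) + ENNReal.ofReal (y ⬝ᵥ ((V - U) *ᵥ y)))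
            ∂(gaussianVec d) := lintegral_congr fun y => by
              rw [hquad, ENNReal.ofReal_add (hnn hU g) (hnn hD y)]
        _ = ENNReal.ofReal (g ⬝ᵥ (U *ᵥ g)) + ENNReal.ofReal (V - U).trace := by
          rw [lintegral_add_left measurable_const, lintegral_quadratic_gaussianVec (hnn hD)]
          simp
        _ ≤ _ := by
          gcongr
          rw [show (2 : ℝ≥0∞) = ENNReal.ofReal 2 by simp]
          apply ENNReal.ofReal_le_ofReal
          rw [Matrix.trace_sub]
          linarith
    refine (lintegral_mono hstep).trans ?_
    rw [lintegral_add_right _ measurable_const]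
    simp only [lintegral_const, measure_univ, mul_one]
    push_cast
    rw [mul_add, mul_one]
    gcongr

end AdaptiveVMV

/-! ### From rejection probabilities to a query bound. -/

namespace AdaptiveVMV

variable {d q : ℕ} {Ω : Type*} [MeasurableSpace Ω]

/-- Over a Gaussian spike, a one-sided algorithm rejects with probability at most `2 c q`. -/
lemma IsOneSided.measure_run_spike_le {T : AdaptiveVMV d q Ω} (hT : T.IsOneSided) (ω : Ω) {c : ℝ}
    (hc : 0 ≤ c) :
    gaussianVec d {g | T.run (spike c g) ω = false} ≤ ENNReal.ofReal c * (2 * q) := by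
  have hm : Measurable fun g : Fin d → ℝ => ENNReal.ofReal c *
      ENNReal.ofReal (g ⬝ᵥ (T.revealed ω q (T.answers (spike c g) ω q) *ᵥ g)) := by
    refine (measurable_dotProduct measurable_id (measurable_mulVec (fun i j => ?_)
      measurable_id)).ennreal_ofReal.const_mul _
    exact (T.measurable_revealed ω q i j).comp
      (T.measurable_answers_spike c q measurable_const measurable_id)
  calc gaussianVec d {g | T.run (spike c g) ω = false}
      ≤ gaussianVec d {g | 1 ≤ ENNReal.ofReal c *
          ENNReal.ofReal (g ⬝ᵥ (T.revealed ω q (T.answers (spike c g) ω q) *ᵥ g))} := by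
        refine measure_mono fun g hg => ?_
        simp only [Set.mem_ofPred_eq] at hg ⊢
        rw [← ENNReal.ofReal_mul hc, ENNReal.one_le_ofReal]
        by_contra h
        rw [hT.run_spike_eq_true ω hc (not_le.1 h).le] at hg
        exact Bool.noConfusion hg
    _ ≤ ∫⁻ g, ENNReal.ofReal c *
          ENNReal.ofReal (g ⬝ᵥ (T.revealed ω q (T.answers (spike c g) ω q) *ᵥ g))
          ∂(gaussianVec d) := by
        -- Markov's inequality at level 1.
        simpa using mul_meas_ge_le_lintegral hm 1
    _ ≤ _ := by
        rw [lintegral_const_mul' _ _ ENNReal.ofReal_ne_top]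
        gcongr
        exact T.lintegral_revealed_le ω c q

lemma measurableSet_run_spike_eq_false (T : AdaptiveVMV d q Ω) (c : ℝ) :
    MeasurableSet {z : Ω × (Fin d → ℝ) | T.run (spike c z.2) z.1 = false} :=
  (T.measurable_output.comp (measurable_fst.prodMk
    (T.measurable_answers_spike c q measurable_fst measurable_snd)))
    (measurableSet_singleton false)

/-- If the spike is far from positive semidefinite with probability at least `β`, then rejecting
it requires of the order of `β / c` queries. -/
lemma IsTester.le_mul_queries {T : AdaptiveVMV d q Ω} {μ : Measure Ω} [IsProbabilityMeasure μ]
    {ε : ℝ} {p : ℝ≥0∞} (hT : T.IsTester μ ε p) (h1 : T.IsOneSided) {c β : ℝ} (hc : 0 ≤ c)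
    (hβ : 0 ≤ β) {s : Set (Fin d → ℝ)} (hs : ENNReal.ofReal β ≤ gaussianVec d s)
    (hfar : ∀ g ∈ s, IsFarFromPSD ε p (spike c g)) :
    β ≤ 3 * c * q := by
  have hS := T.measurableSet_run_spike_eq_false c
  -- The joint rejection probability is bounded below by fixing the spike and averaging over seeds,
  -- and above by fixing the seed and averaging over spikes.
  have hlow : ENNReal.ofReal β * (2 / 3) ≤
      (μ.prod (gaussianVec d)) {z | T.run (spike c z.2) z.1 = false} := by
    rw [Measure.prod_apply_symm hS]
    calc ENNReal.ofReal β * (2 / 3) ≤ gaussianVec d s * (2 / 3) := by gcongr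
      _ = (2 / 3) * gaussianVec d s := mul_comm _ _
      _ ≤ (2 / 3) * gaussianVec d {g | 2 / 3 ≤ μ {ω | T.run (spike c g) ω = false}} := by
        gcongr
        exact fun g hg => hT.2 _ (hfar g hg)
      _ ≤ _ := mul_meas_ge_le_lintegral (measurable_measure_prodMk_right hS) _
  have hup : (μ.prod (gaussianVec d)) {z | T.run (spike c z.2) z.1 = false} ≤
      ENNReal.ofReal c * (2 * q) := by
    rw [Measure.prod_apply hS]
    calc _ ≤ ∫⁻ _, ENNReal.ofReal c * (2 * q) ∂μ :=
          lintegral_mono fun ω => h1.measure_run_spike_le ω hc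
      _ = _ := by simp
  have h := hlow.trans hup
  have h23 : (2 / 3 : ℝ≥0∞) = ENNReal.ofReal (2 / 3) := by
    rw [ENNReal.ofReal_div_of_pos (by norm_num)]
    simp
  have h2q : (2 * q : ℝ≥0∞) = ENNReal.ofReal (2 * q) := by
    rw [ENNReal.ofReal_mul (by norm_num)]
    simp
  rw [h23, h2q, ← ENNReal.ofReal_mul hβ, ← ENNReal.ofReal_mul hc,
    ENNReal.ofReal_le_ofReal_iff (by positivity)] at h
  linarith

end AdaptiveVMV

end PSDTesting

theorem mainTheorem2 (ε₀ : ℝ) (hε₀ : ε₀ < 1) :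
    ∃ c : ℝ, 0 < c ∧
      ∀ (p : ℝ≥0∞), 1 ≤ p → ∀ (d : ℕ), 1 ≤ d → ∀ (ε : ℝ), 0 < ε → ε ≤ ε₀ →
      ∀ (q : ℕ) (Ω : Type*) [MeasurableSpace Ω] (μ : Measure Ω) [IsProbabilityMeasure μ]
        (T : PSDTesting.AdaptiveVMV d q Ω), T.IsTester μ ε p → T.IsOneSided →
        c * min (d : ℝ) ((d : ℝ) ^ (1 - (p⁻¹).toReal) / ε) ≤ (q : ℝ) := by
  obtain ⟨β, hβ, hball⟩ := PSDTesting.exists_small_ball_gaussianVec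
  have he : 0 < 1 - ε₀ := by linarith
  -- One β is the probability of a long g, the other its length; 6 = 3 · 2 combines `hq'` and `hm3`.
  refine ⟨β ^ 2 * (1 - ε₀) / 6, by positivity, ?_⟩
  intro p hp d hd ε hε hεε₀ q Ω _ μ _ T hT h1
  have hd0 : (0 : ℝ) < d := by exact_mod_cast hd
  set D : ℝ := (d : ℝ) ^ (p⁻¹).toReal with hD
  have hD0 : 0 < D := by positivity
  have hDd : (d : ℝ) ^ (1 - (p⁻¹).toReal) * D = d := by
    rw [hD, ← Real.rpow_add hd0, sub_add_cancel, Real.rpow_one]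
  -- A value of L that makes the spike far for this ε, using 1 - ε ≥ 1 - ε₀.
  set x : ℝ := ε * D / (1 - ε₀) with hx
  have hx0 : 0 < x := by positivity
  have hxD : (1 - ε₀) * x = ε * D := by
    rw [hx]
    field_simp
  -- This c gives c|g|² - 1 ≥ x as soon as |g|² ≥ βd.
  have hq := hT.le_mul_queries h1 (c := (1 + x) / (β * d)) (by positivity) hβ.le (hball d hd)
    fun g hg => by
      have hg' : x ≤ (1 + x) / (β * d) * (g ⬝ᵥ g) - 1 := by
        have h2 : (1 + x) / (β * d) * (β * d) ≤ (1 + x) / (β * d) * (g ⬝ᵥ g) :=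
          mul_le_mul_of_nonneg_left hg (by positivity)
        rw [div_mul_cancel₀ _ (by positivity)] at h2
        linarith
      refine PSDTesting.isFarFromPSD_spike hp hε (hx0.trans_le hg') ?_
      rw [← hD, ← hxD]
      exact mul_le_mul (by linarith) hg' hx0.le (by linarith)
  have hq' : β ^ 2 * d ≤ 3 * (1 + x) * q := by
    have h2 := mul_le_mul_of_nonneg_right hq (mul_pos hβ hd0).le
    have h3 : 3 * ((1 + x) / (β * d)) * q * (β * d) = 3 * (1 + x) * q := by
      field_simp
    rw [h3] at h2
    linarith
  set m := min (d : ℝ) ((d : ℝ) ^ (1 - (p⁻¹).toReal) / ε) with hm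
  have hm0 : 0 ≤ m := by positivity
  have hm1 : m ≤ d := min_le_left _ _
  have hm2 : m * (ε * D) ≤ d := by
    calc m * (ε * D) ≤ (d : ℝ) ^ (1 - (p⁻¹).toReal) / ε * (ε * D) :=
          mul_le_mul_of_nonneg_right (min_le_right _ _) (by positivity)
      _ = (d : ℝ) ^ (1 - (p⁻¹).toReal) * D := by field_simp
      _ = d := hDd
  -- Each entry of the minimum pays for one summand of 1 + εD.
  have hm3 : m * ((1 - ε₀) * (1 + x)) ≤ 2 * d := by
    have h2 : (1 - ε₀) * (1 + x) ≤ 1 + ε * D := by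
      rw [mul_add, hxD]
      linarith
    have := mul_le_mul_of_nonneg_left h2 hm0
    linarith
  refine le_of_mul_le_mul_right ?_ (by positivity : (0 : ℝ) < 1 + x)
  have := mul_le_mul_of_nonneg_left hm3 (sq_nonneg β)
  linarith
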